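/- Let $\mathcal H=\bigotimes_{i=1}^N\mathbb C^{d_i}$ and let $\mathcal N=(\mathcal N_1,\dots,\mathcal N_K)$ be a neighborhood structure, i.e. a list of subsets of $\{1,\dots,N\}$. For $S\subseteq\{1,\dots,N\}$ write $\mathcal H_S=\bigotimes_{i\in S}\mathbb C^{d_i}$, $\overline S$ for the complement of $S$, and $\mathcal H=\mathcal H_S\otimes\mathcal H_{\overline S}$. Call $\mathcal N$ connected if its neighborhoods cannot be separated into two nonempty classes such that no neighborhood of the first class intersects a neighborhood of the second. A neighborhood map for $\mathcal N_k$ is a CPTP map on $\mathcal B(\mathcal H)$ of the form $\mathcal E_{\mathcal N_k}\otimes\mathrm{id}_{\overline{\mathcal N}_k}$. A state $\rho$ is finite-time stabilizable (FTS) with respect to $\mathcal N$ if there are finitely many neighborhood maps $\mathcal E_1,\dots,\mathcal E_T$, each for some neighborhood of $\mathcal N$, with $\mathcal E_t(\rho)=\rho$ for all $t$ and $(\mathcal E_T\circ\dots\circ\mathcal E_1)(\sigma)=\rho$ for every density operator $\sigma$ on $\mathcal H$ ($\rho$ is FTS in $T$ steps if $T$ is the smallest such number). For a unit vector $|\psi\rangle\in\mathcal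 H$, let $\Sigma_{\mathcal N_k}(|\psi\rangle)\subseteq\mathcal H_{\mathcal N_k}$ be its Schmidt span: the span of the $\mathcal H_{\mathcal N_k}$-vectors of a Schmidt decomposition of $|\psi\rangle$ in $\mathcal H_{\mathcal N_k}\otimes\mathcal H_{\overline{\mathcal N}_k}$. Let $\mathcal U_{|\psi\rangle}$ be the group of unitaries $U$ on $\mathcal H$ with $U|\psi\rangle\langle\psi|U^\dagger=|\psi\rangle\langle\psi|$, let $\mathcal U_{\mathcal N_k,|\psi\rangle}$ be its subgroup of elements of the form $V\otimes\mathbb I_{\overline{\mathcal N}_k}$ with $V$ unitary on $\mathcal H_{\mathcal N_k}$, and let $\mathfrak u_{|\psi\rangle}$, $\mathfrak u_{\mathcal N_k,|\psi\rangle}$ be the (real) Lie algebras of these groups. **Theorem.** Suppose that $\mathcal N$ is connected, that some neighborhood $\mathcal N_k$ satisfies the small Schmidt span condition $2\dim\Sigma_{\mathcal N_k}(|\psi\rangle)\le\dim\mathcal H_{\mathcal N_k}$, and that the smallest real Lie algebra containing all $\mathfrak u_{\mathcal N_\ell,|\psi\rangle}$, $\ell=1,\dots,K$, is $\mathfrak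 u_{|\psi\rangle}$. Then $|\psi\rangle\langle\psi|$ is FTS with respect to $\mathcal N$. Moreover, for each such $k$ there are a single neighborhood map $\mathcal W$ for $\mathcal N_k$, not a unitary conjugation, with $\mathcal W(|\psi\rangle\langle\psi|)=|\psi\rangle\langle\psi|$, and finitely many unitaries $U_1,\dots,U_m\in\mathcal U_{|\psi\rangle}$, each a finite product of elements of the groups $\mathcal U_{\mathcal N_\ell,|\psi\rangle}$, such that, with $\mathcal U_j(\cdot)=U_j\cdot U_j^\dagger$, $$(\mathcal W\circ\mathcal U_m\circ\dots\circ\mathcal W\circ\mathcal U_1)(\sigma)=|\psi\rangle\langle\psi|\qquad\text{for every density operator }\sigma\text{ on }\mathcal H.$$ -/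

import Mathlib

open scoped Kronecker ComplexOrder

noncomputable section

namespace QLStab

/-! ### Bipartite spaces and the Schmidt span -/

section Bipartite

variable {α β : Type*} [Fintype α] [Fintype β]

/-- The product vector `u ⊗ w` in `ℂ^α ⊗ ℂ^β = ℂ^(α × β)`. -/
def prodVec (u : EuclideanSpace ℂ α) (w : EuclideanSpace ℂ β) : EuclideanSpace ℂ (α × β) :=
  WithLp.toLp 2 fun p => u p.1 * w p.2

/-- `v = ∑ i, s i • (a i ⊗ b i)` is a Schmidt decomposition of `v`. -/
structure IsSchmidtDecomposition (v : EuclideanSpace ℂ (α × β)) {r : ℕ} (s : Fin r → ℝ)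
    (a : Fin r → EuclideanSpace ℂ α) (b : Fin r → EuclideanSpace ℂ β) : Prop where
  pos : ∀ i, 0 < s i
  orthonormal_left : Orthonormal ℂ a
  orthonormal_right : Orthonormal ℂ b
  sum_eq : v = ∑ i, (s i : ℂ) • prodVec (a i) (b i)

/-- The Schmidt span of `v` with respect to the first factor: the span of the contractions of `v`
with the basis vectors of the second factor.  By `schmidtSpan_eq_span` below this is the span of
the left vectors of any Schmidt decomposition of `v`. -/
def schmidtSpan (v : EuclideanSpace ℂ (α × β)) : Submodule ℂ (EuclideanSpace ℂ α) :=
  Submodule.span ℂ (Set.range fun y : β => (WithLp.toLp 2 fun x : α => v (x, y)))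

theorem schmidtSpan_eq_span (v : EuclideanSpace ℂ (α × β)) {r : ℕ} (s : Fin r → ℝ)
    (a : Fin r → EuclideanSpace ℂ α) (b : Fin r → EuclideanSpace ℂ β)
    (h : IsSchmidtDecomposition v s a b) :
    schmidtSpan v = Submodule.span ℂ (Set.range a) := by
  have hv : ∀ x y, v (x, y) = ∑ i, (s i : ℂ) * (a i x * b i y) := by
    intro x y
    rw [h.sum_eq]
    simp [prodVec]
  apply le_antisymm
  · rw [schmidtSpan, Submodule.span_le]
    rintro _ ⟨y, rfl⟩
    have : (WithLp.toLp 2 fun x : α => v (x, y)) = ∑ i, ((s i : ℂ) * b i y) • a i := by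
      ext x
      simp only [hv, WithLp.ofLp_sum, Finset.sum_apply, WithLp.ofLp_smul,
        Pi.smul_apply, smul_eq_mul]
      exact Finset.sum_congr rfl fun i _ => by ring
    show (WithLp.toLp 2 fun x : α => v (x, y)) ∈ Submodule.span ℂ (Set.range a)
    rw [this]
    exact Submodule.sum_mem _ fun i _ =>
      Submodule.smul_mem _ _ (Submodule.subset_span ⟨i, rfl⟩)
  · rw [Submodule.span_le]
    rintro _ ⟨j, rfl⟩
    have hb : ∀ i, ∑ y, star (b j y) * b i y = if j = i then 1 else 0 := by
      intro i
      have := orthonormal_iff_ite.1 h.orthonormal_right j i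
      rw [← this]
      simp [PiLp.inner_apply, mul_comm]
    have hne : (s j : ℂ) ≠ 0 := by exact_mod_cast (h.pos j).ne'
    have key : a j = (s j : ℂ)⁻¹ •
        ∑ y, star (b j y) • (WithLp.toLp 2 fun x : α => v (x, y) : EuclideanSpace ℂ α) := by
      rw [eq_inv_smul_iff₀ hne]
      ext x
      simp only [WithLp.ofLp_sum, Finset.sum_apply, WithLp.ofLp_smul, Pi.smul_apply, smul_eq_mul,
        hv, Finset.mul_sum]
      rw [Finset.sum_comm]
      have : ∀ i, ∑ y, star (b j y) * ((s i : ℂ) * (a i x * b i y)) =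
          (s i : ℂ) * a i x * (if j = i then 1 else 0) := by
        intro i
        rw [← hb i, Finset.mul_sum]
        exact Finset.sum_congr rfl fun y _ => by ring
      rw [Finset.sum_congr rfl fun i _ => this i]
      simp
    show a j ∈ schmidtSpan v
    rw [key]
    exact Submodule.smul_mem _ _ (Submodule.sum_mem _ fun y _ =>
      Submodule.smul_mem _ _ (Submodule.subset_span ⟨y, rfl⟩))

end Bipartite

/-! ### States and channels -/

section Channels

variable {n m : Type*} [Fintype n] [Fintype m]

/-- The rank-one operator `|ψ⟩⟨ψ|`. -/
def ketbra (ψ : EuclideanSpace ℂ n) : Matrix n n ℂ :=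
  Matrix.vecMulVec ψ.ofLp (star ψ.ofLp)

/-- Density operators. -/
def IsDensity (σ : Matrix n n ℂ) : Prop := σ.PosSemidef ∧ σ.trace = 1

/-- The tensor product `Φ ⊗ id` of a linear map `Φ` on operators on `ℂ^n` with the identity map on
operators on `ℂ^m`: it applies `Φ` to every block `(M ((·, x) , (·, y)))`. -/
def tensorId (m : Type*) (Φ : Matrix n n ℂ →ₗ[ℂ] Matrix n n ℂ) :
    Matrix (n × m) (n × m) ℂ →ₗ[ℂ] Matrix (n × m) (n × m) ℂ where
  toFun M := Matrix.of fun p q =>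
    Φ (Matrix.of fun i j => M (i, p.2) (j, q.2)) p.1 q.1
  map_add' M M' := by
    ext p q
    have : (Matrix.of fun i j => (M + M') (i, p.2) (j, q.2)) =
        (Matrix.of fun i j => M (i, p.2) (j, q.2)) +
          (Matrix.of fun i j => M' (i, p.2) (j, q.2)) := rfl
    simp only [Matrix.of_apply, Matrix.add_apply]
    rw [← Matrix.add_apply, ← map_add, ← this]
    rfl
  map_smul' c M := by
    ext p q
    have : (Matrix.of fun i j => (c • M) (i, p.2) (j, q.2)) =
        c • (Matrix.of fun i j => M (i, p.2) (j, q.2)) := rfl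
    simp only [Matrix.of_apply, Matrix.smul_apply, RingHom.id_apply]
    rw [← Matrix.smul_apply, ← map_smul, ← this]
    rfl

/-- Complete positivity: `Φ ⊗ id` preserves positive semidefiniteness for every ancilla `ℂ^k`. -/
def IsCompletelyPositive (Φ : Matrix n n ℂ →ₗ[ℂ] Matrix n n ℂ) : Prop :=
  ∀ (k : ℕ) (M : Matrix (n × Fin k) (n × Fin k) ℂ),
    M.PosSemidef → (tensorId (Fin k) Φ M).PosSemidef

/-- Completely positive trace-preserving maps. -/
def IsCPTP (Φ : Matrix n n ℂ →ₗ[ℂ] Matrix n n ℂ) : Prop :=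
  IsCompletelyPositive Φ ∧ ∀ M, (Φ M).trace = M.trace

/-- The map `ρ ↦ U ρ U†`. -/
def conjMap (U : Matrix n n ℂ) : Matrix n n ℂ →ₗ[ℂ] Matrix n n ℂ where
  toFun M := U * M * U.conjTranspose
  map_add' M M' := by rw [Matrix.mul_add, Matrix.add_mul]
  map_smul' c M := by simp

/-- The evolution `σ ↦ (E_T ∘ ⋯ ∘ E_1) σ` along the list `[E_1, …, E_T]` (head applied first). -/
def evolve (l : List (Matrix n n ℂ →ₗ[ℂ] Matrix n n ℂ)) (σ : Matrix n n ℂ) : Matrix n n ℂ :=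
  l.foldl (fun ρ E => E ρ) σ

variable [DecidableEq n]

/-- The unitary stabilizer group of `ψ`, as a set of matrices. -/
def stabilizerGroup (ψ : EuclideanSpace ℂ n) : Set (Matrix n n ℂ) :=
  {U | U ∈ Matrix.unitaryGroup n ℂ ∧ U * ketbra ψ * U.conjTranspose = ketbra ψ}

/-- The (real) Lie algebra of a closed matrix group `G`. -/
def lieAlgebraOf (G : Set (Matrix n n ℂ)) : Set (Matrix n n ℂ) :=
  {X | ∀ t : ℝ, NormedSpace.exp (t • X) ∈ G}

/-- A map on operators that is not conjugation by a unitary. -/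
def IsDissipative (Φ : Matrix n n ℂ →ₗ[ℂ] Matrix n n ℂ) : Prop :=
  ¬ ∃ U ∈ Matrix.unitaryGroup n ℂ, Φ = conjMap U

end Channels

/-! ### The multipartite system: `N` subsystems, the `i`-th one being `ℂ^(d i)` -/

section Multipartite

variable {N K : ℕ} {d : Fin N → ℕ}

/-- Basis labels of the whole system. -/
abbrev Conf (d : Fin N → ℕ) : Type := ∀ i, Fin (d i)

/-- Basis labels of the subsystems in `S`. -/
abbrev ConfIn (d : Fin N → ℕ) (S : Finset (Fin N)) : Type := ∀ i : {i // i ∈ S}, Fin (d i)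

/-- Basis labels of the subsystems outside `S`. -/
abbrev ConfOut (d : Fin N → ℕ) (S : Finset (Fin N)) : Type := ∀ i : {i // i ∉ S}, Fin (d i)

/-- The identification `ℋ = ℋ_S ⊗ ℋ_{Sᶜ}` at the level of basis labels. -/
def splitConf (d : Fin N → ℕ) (S : Finset (Fin N)) : Conf d ≃ ConfIn d S × ConfOut d S :=
  Equiv.piEquivPiSubtypeProd (fun i => i ∈ S) (fun i => Fin (d i))

/-- A vector of `ℋ` regarded as a vector of `ℋ_S ⊗ ℋ_{Sᶜ}`. -/
def splitVec (S : Finset (Fin N)) (ψ : EuclideanSpace ℂ (Conf d)) :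
    EuclideanSpace ℂ (ConfIn d S × ConfOut d S) :=
  WithLp.toLp 2 fun p => ψ ((splitConf d S).symm p)

/-- The Schmidt span `Σ_S(ψ) ≤ ℋ_S`. -/
def nbhdSchmidtSpan (S : Finset (Fin N)) (ψ : EuclideanSpace ℂ (Conf d)) :
    Submodule ℂ (EuclideanSpace ℂ (ConfIn d S)) :=
  schmidtSpan (splitVec S ψ)

/-- The small Schmidt span condition `2 dim Σ_S(ψ) ≤ dim ℋ_S`. -/
def SmallSchmidtSpan (S : Finset (Fin N)) (ψ : EuclideanSpace ℂ (Conf d)) : Prop :=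
  2 * Module.finrank ℂ (nbhdSchmidtSpan S ψ) ≤ Module.finrank ℂ (EuclideanSpace ℂ (ConfIn d S))

/-- The operator `A ⊗ 𝟙` on `ℋ`, for `A` acting on `ℋ_S`. -/
def localOp (S : Finset (Fin N)) (A : Matrix (ConfIn d S) (ConfIn d S) ℂ) :
    Matrix (Conf d) (Conf d) ℂ :=
  (A ⊗ₖ (1 : Matrix (ConfOut d S) (ConfOut d S) ℂ)).submatrix (splitConf d S) (splitConf d S)

/-- The map `F ⊗ id` on operators on `ℋ`, for `F` a map on operators on `ℋ_S`. -/
def localMap (S : Finset (Fin N))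
    (F : Matrix (ConfIn d S) (ConfIn d S) ℂ →ₗ[ℂ] Matrix (ConfIn d S) (ConfIn d S) ℂ) :
    Matrix (Conf d) (Conf d) ℂ →ₗ[ℂ] Matrix (Conf d) (Conf d) ℂ :=
  (Matrix.reindexLinearEquiv ℂ ℂ (splitConf d S) (splitConf d S)).symm.toLinearMap ∘ₗ
    tensorId (ConfOut d S) F ∘ₗ
      (Matrix.reindexLinearEquiv ℂ ℂ (splitConf d S) (splitConf d S)).toLinearMap

/-- Neighborhood maps for `S`: CPTP maps `E` of the form `F ⊗ id`, with `F` CPTP on `ℋ_S`. -/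
def IsNeighborhoodMap (S : Finset (Fin N))
    (E : Matrix (Conf d) (Conf d) ℂ →ₗ[ℂ] Matrix (Conf d) (Conf d) ℂ) : Prop :=
  IsCPTP E ∧ ∃ F, IsCPTP F ∧ E = localMap S F

/-- A neighborhood structure is connected if the neighborhoods cannot be separated into two
nonempty classes such that no member of the first one meets a member of the second one. -/
def IsConnectedStructure (𝒩 : Fin K → Finset (Fin N)) : Prop :=
  ∀ A : Set (Fin K), A.Nonempty → Aᶜ.Nonempty →
    ∃ k ∈ A, ∃ l ∈ Aᶜ, (𝒩 k ∩ 𝒩 l).Nonempty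

/-- The neighborhood unitary stabilizer group of `ψ` for the neighborhood `S`. -/
def nbhdStabilizerGroup (S : Finset (Fin N)) (ψ : EuclideanSpace ℂ (Conf d)) :
    Set (Matrix (Conf d) (Conf d) ℂ) :=
  {U | (∃ A ∈ Matrix.unitaryGroup (ConfIn d S) ℂ, U = localOp S A) ∧
    U * ketbra ψ * U.conjTranspose = ketbra ψ}

/-! Matrices carry the commutator bracket `⁅X, Y⁆ = X * Y - Y * X`. -/
attribute [local instance] LieRing.ofAssociativeRing

/-- The smallest real Lie algebra of matrices that contains all neighborhood stabilizer Lie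
algebras is the full stabilizer Lie algebra. -/
def UnitaryGeneration (𝒩 : Fin K → Finset (Fin N)) (ψ : EuclideanSpace ℂ (Conf d)) : Prop :=
  (LieSubalgebra.lieSpan ℝ (Matrix (Conf d) (Conf d) ℂ)
      (⋃ k, lieAlgebraOf (nbhdStabilizerGroup (𝒩 k) ψ)) : Set (Matrix (Conf d) (Conf d) ℂ)) =
    lieAlgebraOf (stabilizerGroup ψ)

/-- There are `T` neighborhood maps, each leaving `ρ` invariant, whose composition sends every
density operator to `ρ`. -/
def HasStabilizingSequence (𝒩 : Fin K → Finset (Fin N)) (ρ : Matrix (Conf d) (Conf d) ℂ)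
    (T : ℕ) : Prop :=
  ∃ l : List (Matrix (Conf d) (Conf d) ℂ →ₗ[ℂ] Matrix (Conf d) (Conf d) ℂ),
    l.length = T ∧ (∀ E ∈ l, (∃ k, IsNeighborhoodMap (𝒩 k) E) ∧ E ρ = ρ) ∧
      ∀ σ, IsDensity σ → evolve l σ = ρ

/-- `ρ` is finite-time stabilizable in `T` steps; `T` is the least possible length. -/
def IsFTSIn (𝒩 : Fin K → Finset (Fin N)) (ρ : Matrix (Conf d) (Conf d) ℂ) (T : ℕ) : Prop :=
  HasStabilizingSequence 𝒩 ρ T ∧ ∀ T' < T, ¬ HasStabilizingSequence 𝒩 ρ T'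

/-- `ρ` is finite-time stabilizable with respect to the neighborhood structure `𝒩`. -/
def IsFTS (𝒩 : Fin K → Finset (Fin N)) (ρ : Matrix (Conf d) (Conf d) ℂ) : Prop :=
  ∃ T, IsFTSIn 𝒩 ρ T

/-- `U` is a finite product of neighborhood stabilizers of `ψ`. -/
def IsCompiled (𝒩 : Fin K → Finset (Fin N)) (ψ : EuclideanSpace ℂ (Conf d))
    (U : Matrix (Conf d) (Conf d) ℂ) : Prop :=
  ∃ l : List (Matrix (Conf d) (Conf d) ℂ),
    (∀ V ∈ l, ∃ k, V ∈ nbhdStabilizerGroup (𝒩 k) ψ) ∧ l.prod = U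

end Multipartite

end QLStab

end

open scoped Kronecker ComplexOrder

noncomputable section

namespace QLStab

/-! ### Matrix groups generated by one-parameter subgroups -/

section Generation

open Filter Topology

variable {𝔸 : Type*} [NormedRing 𝔸] [NormedAlgebra ℝ 𝔸]

/-! Two independent facts combine: an explicit cooling scheme built from reflections, and exact
compilation of those reflections.

Cooling. The small Schmidt span leaves room in `ℋ_{𝒩 k}` for a partial isometry from the Schmidt
span into its orthogonal complement (`exists_partialIsometry`). Let `J` be its extension to `ℋ` and
`W` the channel with Kraus operators `1 - J J†` and `J†`. Then `J† J ψ = ψ` and `J† ψ = 0`, so `W`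
fixes `ψ`, and every output of `W` has range in `ker J†`. Suppose the range lies in `L ≤ ker J†`
with `ψ ∈ L`. For a unit vector `e ∈ L` orthogonal to `ψ`, the reflection swapping `e` with `J ψ`
fixes `ψ`; a following `W` sends `J ψ` to `ψ`, so the range shrinks into `L ⊓ e^⊥`. Repetition ends
in the line of `ψ` (`exists_reflections_of_le`).

Compilation. Let `Γ` be the monoid of products of neighborhood stabilizers. The span of the
generators of one-parameter groups in `Γ` is closed under commutators, so by the generation
hypothesis it contains the stabilizer Lie algebra. Products of exponentials then fill a
neighbourhood of `1` in the stabilizer group (`eventually_mem_of_le_span_oneParam`). A reflection is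
the `m`-th power of a phase close to `1`, hence lies in `Γ` exactly, not just approximately
(`reflection_mem_compiledSubmonoid`). -/

/-- The generators of the one-parameter groups contained in `Γ`. -/
def oneParam (Γ : Submonoid 𝔸) : Set 𝔸 := {X | ∀ t : ℝ, NormedSpace.exp (t • X) ∈ Γ}

/-- Uniqueness of square roots near `1`: `A (A - B) + (A - B) B = A² - B² = 0`, and replacing both
outer factors by `1` would give `2 (A - B)`, with an error of norm less than `2 ‖A - B‖` unless `A =
B`. -/
theorem eq_of_mul_self_eq {A B : 𝔸} (hA : ‖A - 1‖ < 1) (hB : ‖B - 1‖ < 1)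
    (h : A * A = B * B) : A = B := by
  by_contra hne
  have hD : 0 < ‖A - B‖ := norm_pos_iff.2 (sub_ne_zero.2 hne)
  have h2 : (2 : ℝ) • (A - B) = -((A - 1) * (A - B) + (A - B) * (B - 1)) := by
    rw [two_smul]
    have hz : A * (A - B) + (A - B) * B = 0 := by rw [mul_sub, sub_mul, h]; abel
    have hs : (A - 1) * (A - B) + (A - B) * (B - 1) =
        A * (A - B) + (A - B) * B - (A - B) - (A - B) := by noncomm_ring
    rw [hs, hz]
    abel
  have h3 : 2 * ‖A - B‖ ≤ ‖A - 1‖ * ‖A - B‖ + ‖A - B‖ * ‖B - 1‖ := by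
    calc 2 * ‖A - B‖ = ‖(2 : ℝ) • (A - B)‖ := by rw [norm_smul]; simp
      _ ≤ _ := by
        rw [h2, norm_neg]
        exact (norm_add_le _ _).trans (add_le_add (norm_mul_le _ _) (norm_mul_le _ _))
  nlinarith

/-- A unitary close to the identity is determined by its skew-adjoint part. -/
theorem unitary_eq_of_sub_star_eq [StarRing 𝔸] {U V : 𝔸} (hU : U ∈ unitary 𝔸) (hV : V ∈ unitary 𝔸)
    (hU1 : ‖(2⁻¹ : ℝ) • (U + star U) - 1‖ < 1) (hV1 : ‖(2⁻¹ : ℝ) • (V + star V) - 1‖ < 1)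
    (h : U - star U = V - star V) : U = V := by
  -- For unitary `W`, `(W + W*)² = (W - W*)² + 4`: the skew part determines the square of the
  -- self-adjoint part.
  have key : ∀ W ∈ unitary 𝔸, ((2⁻¹ : ℝ) • (W + star W)) * ((2⁻¹ : ℝ) • (W + star W)) =
      (4⁻¹ : ℝ) • ((W - star W) * (W - star W) + 4) := by
    intro W hW
    have e1 := Unitary.star_mul_self_of_mem hW
    have e2 := Unitary.mul_star_self_of_mem hW
    rw [smul_mul_smul_comm]
    norm_num only
    congr 1
    rw [show (4 : 𝔸) = 1 + 1 + 1 + 1 by norm_num]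
    simp only [add_mul, mul_add, sub_mul, mul_sub, e1, e2]
    abel
  have h1 := eq_of_mul_self_eq hU1 hV1 (by rw [key U hU, key V hV, h])
  have h2 : U + star U = V + star V := by
    have := congrArg (fun x => (2 : ℝ) • x) h1
    simpa using this
  have h3 : (2 : ℝ) • U = (2 : ℝ) • V := by
    rw [two_smul, two_smul]
    calc U + U = (U + star U) + (U - star U) := by abel
      _ = (V + star V) + (V - star V) := by rw [h2, h]
      _ = V + V := by abel
  simpa using congrArg (fun x => (2⁻¹ : ℝ) • x) h3

section Exp

variable [CompleteSpace 𝔸]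

theorem exp_smul_mul_exp_neg_smul (X : 𝔸) (t : ℝ) :
    NormedSpace.exp (t • X) * NormedSpace.exp ((-t) • X) = 1 := by
  let _ := NormedAlgebra.restrictScalars ℚ ℝ 𝔸
  rw [← NormedSpace.exp_add_of_commute]
  · rw [neg_smul, add_neg_cancel, NormedSpace.exp_zero]
  · exact ((Commute.refl X).smul_left t).smul_right (-t)

theorem oneParam_conj {Γ : Submonoid 𝔸} {X Y : 𝔸} (hX : X ∈ oneParam Γ) (hY : Y ∈ oneParam Γ)
    (t : ℝ) : NormedSpace.exp (t • X) * Y * NormedSpace.exp ((-t) • X) ∈ oneParam Γ := by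
  let _ := NormedAlgebra.restrictScalars ℚ ℝ 𝔸
  intro s
  let g : 𝔸ˣ := ⟨NormedSpace.exp (t • X), NormedSpace.exp ((-t) • X),
    exp_smul_mul_exp_neg_smul X t, by simpa using exp_smul_mul_exp_neg_smul X (-t)⟩
  have h := NormedSpace.exp_units_conj g (s • Y)
  have h2 : s • (NormedSpace.exp (t • X) * Y * NormedSpace.exp ((-t) • X)) =
      (g : 𝔸) * (s • Y) * ((g⁻¹ : 𝔸ˣ) : 𝔸) := by
    rw [mul_smul_comm, smul_mul_assoc]; rfl
  rw [h2, h]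
  exact Γ.mul_mem (Γ.mul_mem (hX t) (hY s)) (hX (-t))

theorem hasDerivAt_exp_conj (X Y : 𝔸) :
    HasDerivAt (fun t : ℝ => NormedSpace.exp (t • X) * Y * NormedSpace.exp ((-t) • X))
      (X * Y - Y * X) 0 := by
  have h1 := (hasDerivAt_exp_smul_const X (0 : ℝ)).mul_const Y
  have h2 := (hasDerivAt_exp_smul_const X (-(0 : ℝ))).scomp (0 : ℝ) (hasDerivAt_neg (0 : ℝ))
  have h3 := h1.mul h2
  refine h3.congr_deriv ?_
  simp [sub_eq_add_neg]

end Exp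

variable [FiniteDimensional ℝ 𝔸]

/-- Conjugating `Y` by `exp (tX)` stays among the generators. The difference quotients at `t = 0`
therefore lie in the span, which is closed by finite dimension, and their limit is the commutator.
Bilinearity does the rest. -/
theorem commutator_mem_span_oneParam {Γ : Submonoid 𝔸} {X Y : 𝔸}
    (hX : X ∈ Submodule.span ℝ (oneParam Γ)) (hY : Y ∈ Submodule.span ℝ (oneParam Γ)) :
    X * Y - Y * X ∈ Submodule.span ℝ (oneParam Γ) := by
  have := FiniteDimensional.complete ℝ 𝔸
  set V := Submodule.span ℝ (oneParam Γ) with hV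
  induction hX, hY using Submodule.span_induction₂ with
  | mem_mem X Y hX hY =>
    have hd := hasDerivAt_exp_conj X Y
    have hc : IsClosed (V : Set 𝔸) := V.closed_of_finiteDimensional
    refine hc.mem_of_tendsto hd.tendsto_slope (Eventually.of_forall fun t => ?_)
    rw [slope_def_module]
    refine V.smul_mem _ (V.sub_mem ?_ ?_)
    · exact Submodule.subset_span (oneParam_conj hX hY t)
    · exact Submodule.subset_span (oneParam_conj hX hY 0)
  | zero_left y hy => simp
  | zero_right x hx => simp
  | add_left x y z hx hy hz h1 h2 => simpa [add_mul, mul_add, add_sub_add_comm] using V.add_mem h1 h2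
  | add_right x y z hx hy hz h1 h2 =>
    simpa [add_mul, mul_add, add_sub_add_comm] using V.add_mem h1 h2
  | smul_left r x y hx hy h => simpa [smul_sub] using V.smul_mem r h
  | smul_right r x y hx hy h => simpa [smul_sub] using V.smul_mem r h

attribute [local instance] LieRing.ofAssociativeRing in
theorem lieSpan_le_span_oneParam (Γ : Submonoid 𝔸) (s : Set 𝔸) (hs : s ⊆ oneParam Γ) :
    (LieSubalgebra.lieSpan ℝ 𝔸 s : Set 𝔸) ⊆ Submodule.span ℝ (oneParam Γ) := by
  let V : LieSubalgebra ℝ 𝔸 :=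
    { Submodule.span ℝ (oneParam Γ) with
      lie_mem' := fun hX hY => commutator_mem_span_oneParam hX hY }
  exact LieSubalgebra.lieSpan_le (K := V) |>.2 (hs.trans Submodule.subset_span)

/-- A product of one-parameter groups in `Γ`, with prescribed derivative at the identity. -/
theorem exists_hasStrictFDerivAt_prod_exp {ι : Type*} [Fintype ι] (Γ : Submonoid 𝔸) (b : ι → 𝔸)
    (hb : ∀ i, b i ∈ oneParam Γ) :
    ∃ F : (ι → ℝ) → 𝔸, (∀ t, F t ∈ Γ) ∧ F 0 = 1 ∧
      HasStrictFDerivAt F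
        (∑ i, (ContinuousLinearMap.proj (R := ℝ) (φ := fun _ : ι => ℝ) i).smulRight (b i)) 0 := by
  classical
  have := FiniteDimensional.complete ℝ 𝔸
  suffices h : ∀ s : Finset ι, ∃ F : (ι → ℝ) → 𝔸, (∀ t, F t ∈ Γ) ∧ F 0 = 1 ∧
      HasStrictFDerivAt F
        (∑ i ∈ s, (ContinuousLinearMap.proj (R := ℝ) (φ := fun _ : ι => ℝ) i).smulRight (b i)) 0
    from h Finset.univ
  intro s
  induction s using Finset.induction_on with
  | empty => exact ⟨fun _ => 1, fun _ => Γ.one_mem, rfl, by simpa using hasStrictFDerivAt_const 1 0⟩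
  | insert i s his ih =>
    obtain ⟨F, h1, h2, h3⟩ := ih
    have he : HasStrictFDerivAt (fun t : ι → ℝ => NormedSpace.exp (t i • b i))
        ((ContinuousLinearMap.proj (R := ℝ) (φ := fun _ : ι => ℝ) i).smulRight (b i)) 0 := by
      let Λ := (ContinuousLinearMap.proj (R := ℝ) (φ := fun _ : ι => ℝ) i).smulRight (b i)
      have h0 : HasStrictFDerivAt NormedSpace.exp (1 : 𝔸 →L[ℝ] 𝔸) (Λ 0) := by
        rw [map_zero]; exact hasStrictFDerivAt_exp_zero
      exact h0.comp (0 : ι → ℝ) Λ.hasStrictFDerivAt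
    refine ⟨fun t => NormedSpace.exp (t i • b i) * F t, fun t => Γ.mul_mem (hb i _) (h1 t),
      by simp [h2], ?_⟩
    refine (he.mul' h3).congr_fderiv ?_
    rw [Finset.sum_insert his]
    ext t
    simp [h2, add_comm]

variable [StarRing 𝔸] [ContinuousStar 𝔸] [StarModule ℝ 𝔸]

theorem star_eq_neg_of_mem_oneParam {H : Submonoid 𝔸} (hH : H ≤ unitary 𝔸) {X : 𝔸}
    (hX : X ∈ oneParam H) : star X = -X := by
  have := FiniteDimensional.complete ℝ 𝔸
  have h1 := (hasDerivAt_exp_smul_const X (0 : ℝ)).mul (hasDerivAt_exp_smul_const (star X) (0 : ℝ))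
  have h2 : ((fun u : ℝ => NormedSpace.exp (u • X)) * fun u : ℝ => NormedSpace.exp (u • star X)) =
      fun _ => 1 := by
    funext t
    have := Unitary.mul_star_self_of_mem (hH (hX t))
    rw [NormedSpace.star_exp, star_smul, star_trivial] at this
    exact this
  rw [h2] at h1
  have h3 := h1.unique (hasDerivAt_const (0 : ℝ) (1 : 𝔸))
  simp only [zero_smul, NormedSpace.exp_zero, one_mul, mul_one] at h3
  exact eq_neg_of_add_eq_zero_right h3

/-- If the generators of the one-parameter groups in `Γ` span the Lie algebra `u` of `H`, then `Γ`
contains a neighbourhood of the identity in `H`. -/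
theorem eventually_mem_of_le_span_oneParam {Γ H : Submonoid 𝔸} (hΓ : Γ ≤ H) (hH : H ≤ unitary 𝔸)
    (u : Submodule ℝ 𝔸) (hu : oneParam H = u) (hskew : ∀ U ∈ H, U - star U ∈ u)
    (hspan : u ≤ Submodule.span ℝ (oneParam Γ)) :
    ∀ᶠ U in 𝓝 (1 : 𝔸), U ∈ H → U ∈ Γ := by
  have := FiniteDimensional.complete ℝ 𝔸
  obtain ⟨b, hb, hbs, hbi⟩ := exists_linearIndependent ℝ (oneParam Γ)
  have : Fintype b := (hbi.setFinite).fintype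
  have hbu : ∀ x ∈ b, x ∈ u := fun x hx => by
    have : x ∈ (u : Set 𝔸) := hu ▸ fun t => hΓ (hb hx t)
    exact this
  obtain ⟨F, hF1, hF2, hF3⟩ := exists_hasStrictFDerivAt_prod_exp Γ (fun x : b => (x : 𝔸))
    fun x => hb x.2
  -- The chart is `U ↦ π (U - U*)`, valued in `u` itself so that its derivative along `F` can be
  -- onto. This allows the surjective form of the inverse function theorem without a manifold
  -- structure on `H`.
  obtain ⟨π, hπ⟩ := u.subtype.exists_leftInverse_of_injective (by simp)
  have hπ' : ∀ x (hx : x ∈ u), π x = ⟨x, hx⟩ := fun x hx => LinearMap.congr_fun hπ ⟨x, hx⟩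
  let sk : 𝔸 →ₗ[ℝ] 𝔸 := LinearMap.id - (starLinearEquiv ℝ (A := 𝔸)).toLinearMap
  have hsk : ∀ x, sk x = x - star x := fun x => rfl
  let Λ : 𝔸 →L[ℝ] u := (π ∘ₗ sk).toContinuousLinearMap
  have hΛ : ∀ x, Λ x = π (x - star x) := fun x => rfl
  have hG := (Λ.hasStrictFDerivAt (x := F 0)).comp (0 : b → ℝ) hF3
  have hsurj := hG.map_nhds_eq_of_surj (by
    rw [LinearMap.range_eq_top]
    intro y
    have hy : (y : 𝔸) ∈ Submodule.span ℝ (Set.range fun x : b => (x : 𝔸)) := by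
      rw [Subtype.range_coe, hbs]; exact hspan y.2
    obtain ⟨c, hc⟩ := (Submodule.mem_span_range_iff_exists_fun ℝ).1 hy
    -- The half compensates for `y - y* = 2y` on skew-adjoint `y`.
    refine ⟨fun i => 2⁻¹ * c i, ?_⟩
    have : ∑ i, ((2⁻¹ * c i) • (i : 𝔸)) = (2⁻¹ : ℝ) • (y : 𝔸) := by
      rw [← hc, Finset.smul_sum]; simp [mul_smul]
    have hstar : star (y : 𝔸) = -y :=
      star_eq_neg_of_mem_oneParam hH (hu.symm ▸ y.2 : (y : 𝔸) ∈ oneParam H)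
    simp only [ContinuousLinearMap.coe_coe, ContinuousLinearMap.comp_apply,
      sum_apply, ContinuousLinearMap.smulRight_apply,
      ContinuousLinearMap.proj_apply, this, hΛ]
    rw [star_smul, star_trivial, hstar, smul_neg, sub_neg_eq_add, ← add_smul]
    norm_num
    exact hπ' y y.2)
  have hcont : Continuous fun U : 𝔸 => ‖(2⁻¹ : ℝ) • (U + star U) - 1‖ := by fun_prop
  have h1 : ‖(2⁻¹ : ℝ) • ((1 : 𝔸) + star 1) - 1‖ < 1 := by
    rw [star_one, ← two_smul ℝ (1 : 𝔸), smul_smul]; simp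
  have hnear : ∀ᶠ U in 𝓝 (1 : 𝔸), ‖(2⁻¹ : ℝ) • (U + star U) - 1‖ < 1 :=
    hcont.continuousAt.eventually_lt continuousAt_const h1
  have hFc : Tendsto F (𝓝 0) (𝓝 1) := hF2 ▸ hF3.continuousAt
  -- Only parameters with `F t` near `1` are kept, so that equality of skew parts will force `F t =
  -- U`.
  have himg : (Λ ∘ F) '' {t | ‖(2⁻¹ : ℝ) • (F t + star (F t)) - 1‖ < 1} ∈ 𝓝 (Λ 1) := by
    have := image_mem_map (m := Λ ∘ F) (hFc.eventually hnear)
    rw [show map (Λ ∘ F) (𝓝 0) = 𝓝 ((Λ ∘ F) 0) from hsurj] at this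
    simpa [hF2] using this
  filter_upwards [hnear, Λ.continuous.continuousAt.preimage_mem_nhds himg] with U hU hU2 hUH
  obtain ⟨t, ht, htU⟩ := hU2
  have e : F t - star (F t) = U - star U := by
    simp only [Function.comp_apply, hΛ] at htU
    rw [hπ' _ (hskew _ (hΓ (hF1 t))), hπ' _ (hskew _ hUH)] at htU
    exact congrArg Subtype.val htU
  rw [← unitary_eq_of_sub_star_eq (hH (hΓ (hF1 t))) (hH hUH) ht hU e]
  exact hF1 t

end Generation

/-! ### Compiling reflections that fix `ψ` -/

section Compile

open Filter Topology Matrix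

section Stabilizer

variable {n : Type*}

theorem ketbra_conjTranspose (ψ : EuclideanSpace ℂ n) : (ketbra ψ)ᴴ = ketbra ψ := by
  rw [ketbra, Matrix.conjTranspose_vecMulVec, star_star]

theorem commute_conjTranspose_ketbra [Fintype n] {ψ : EuclideanSpace ℂ n} {U : Matrix n n ℂ}
    (h : Commute U (ketbra ψ)) : Commute Uᴴ (ketbra ψ) := by
  have := h.star_star
  rwa [star_eq_conjTranspose, star_eq_conjTranspose, ketbra_conjTranspose] at this

section Phase

variable [DecidableEq n]

/-- The phase `1 + (exp (iθ) - 1) Q` on the range of a projection `Q`. -/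
def phase (Q : Matrix n n ℂ) (θ : ℝ) : Matrix n n ℂ :=
  1 + (Complex.exp (θ * Complex.I) - 1) • Q

theorem phase_conjTranspose {Q : Matrix n n ℂ} (hQ : Qᴴ = Q) (θ : ℝ) :
    (phase Q θ)ᴴ = phase Q (-θ) := by
  simp only [phase, conjTranspose_add, conjTranspose_one, conjTranspose_smul, hQ]
  simp [← Complex.exp_conj]

theorem phase_pi (Q : Matrix n n ℂ) : phase Q Real.pi = 1 - (2 : ℂ) • Q := by
  rw [phase, Complex.exp_pi_mul_I]; module

end Phase

variable [Fintype n] [DecidableEq n]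

/-- Commutation is the convenient form: it passes to products, adjoints, linear combinations and
exponentials. -/
theorem mem_stabilizerGroup_iff {ψ : EuclideanSpace ℂ n} {U : Matrix n n ℂ} :
    U ∈ stabilizerGroup ψ ↔ U ∈ Matrix.unitaryGroup n ℂ ∧ Commute U (ketbra ψ) := by
  refine and_congr_right fun hU => ?_
  have h1 : Uᴴ * U = 1 := Unitary.star_mul_self_of_mem hU
  have h2 : U * Uᴴ = 1 := Unitary.mul_star_self_of_mem hU
  constructor
  · intro h
    show U * ketbra ψ = ketbra ψ * U
    conv_rhs => rw [← h]
    rw [Matrix.mul_assoc, Matrix.mul_assoc, h1, Matrix.mul_one]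
  · intro h
    rw [h.eq, Matrix.mul_assoc, h2, Matrix.mul_one]

/-- The unitary stabilizer group of `ψ` as a submonoid of the matrix algebra. -/
def stabilizerSubmonoid (ψ : EuclideanSpace ℂ n) : Submonoid (Matrix n n ℂ) where
  carrier := stabilizerGroup ψ
  mul_mem' hU hV := by
    rw [mem_stabilizerGroup_iff] at *
    exact ⟨mul_mem hU.1 hV.1, hU.2.mul_left hV.2⟩
  one_mem' := mem_stabilizerGroup_iff.2 ⟨one_mem _, Commute.one_left _⟩

-- `U - U†` is skew-adjoint and commutes with `ketbra ψ`, so its exponentials are unitary and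
-- commute with it too.
attribute [local instance] Matrix.linftyOpNormedRing Matrix.linftyOpNormedAlgebra in
theorem sub_conjTranspose_mem_lieAlgebraOf {ψ : EuclideanSpace ℂ n} {U : Matrix n n ℂ}
    (hU : U ∈ stabilizerGroup ψ) : U - Uᴴ ∈ lieAlgebraOf (stabilizerGroup ψ) := by
  intro t
  have hc := (mem_stabilizerGroup_iff.1 hU).2
  refine mem_stabilizerGroup_iff.2 ⟨?_, ?_⟩
  · let _ := NormedAlgebra.restrictScalars ℚ ℝ (Matrix n n ℂ)
    have : @ContinuousStar (Matrix n n ℂ) PseudoMetricSpace.toUniformSpace.toTopologicalSpace _ :=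
      ⟨continuous_id.matrix_conjTranspose⟩
    refine NormedSpace.exp_mem_unitary_of_mem_skewAdjoint ?_
    rw [skewAdjoint.mem_iff, star_smul, star_trivial, star_sub, ← star_eq_conjTranspose, star_star,
      ← smul_neg, neg_sub]
  · exact (((hc.sub_left (commute_conjTranspose_ketbra hc)).smul_left t).symm.exp_right).symm

theorem phase_mul_phase {Q : Matrix n n ℂ} (hQ : Q * Q = Q) (θ η : ℝ) :
    phase Q θ * phase Q η = phase Q (θ + η) := by
  have : Complex.exp (((θ + η : ℝ) : ℂ) * Complex.I) =
      Complex.exp (θ * Complex.I) * Complex.exp (η * Complex.I) := by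
    rw [← Complex.exp_add]; push_cast; ring_nf
  simp only [phase, this, add_mul, mul_add, one_mul, mul_one, smul_mul_smul_comm, hQ]
  module

theorem phase_pow {Q : Matrix n n ℂ} (hQ : Q * Q = Q) (θ : ℝ) (m : ℕ) :
    phase Q θ ^ m = phase Q (m * θ) := by
  induction m with
  | zero => simp [phase]
  | succ m ih => rw [pow_succ, ih, phase_mul_phase hQ]; push_cast; ring_nf

theorem phase_mem_stabilizerGroup {ψ : EuclideanSpace ℂ n} {Q : Matrix n n ℂ} (hQ : Q * Q = Q)
    (hQs : Qᴴ = Q) (hQψ : Commute Q (ketbra ψ)) (θ : ℝ) : phase Q θ ∈ stabilizerGroup ψ := by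
  refine mem_stabilizerGroup_iff.2 ⟨?_, (Commute.one_left _).add_left (hQψ.smul_left _)⟩
  rw [mem_unitaryGroup_iff, star_eq_conjTranspose, phase_conjTranspose hQs, phase_mul_phase hQ]
  simp [phase]

end Stabilizer

variable {N K : ℕ} {d : Fin N → ℕ}

/-- The products of neighborhood stabilizers of `ψ`. -/
def compiledSubmonoid (𝒩 : Fin K → Finset (Fin N)) (ψ : EuclideanSpace ℂ (Conf d)) :
    Submonoid (Matrix (Conf d) (Conf d) ℂ) :=
  Submonoid.closure {V | ∃ k, V ∈ nbhdStabilizerGroup (𝒩 k) ψ}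

theorem isCompiled_of_mem {𝒩 : Fin K → Finset (Fin N)} {ψ : EuclideanSpace ℂ (Conf d)}
    {U : Matrix (Conf d) (Conf d) ℂ} (h : U ∈ compiledSubmonoid 𝒩 ψ) : IsCompiled 𝒩 ψ U :=
  Submonoid.exists_list_of_mem_closure h

theorem localOp_mul (S : Finset (Fin N)) (A B : Matrix (ConfIn d S) (ConfIn d S) ℂ) :
    localOp S (A * B) = localOp S A * localOp S B := by
  simp only [localOp]
  rw [Matrix.submatrix_mul_equiv, ← Matrix.mul_kronecker_mul, Matrix.mul_one]

theorem localOp_one (S : Finset (Fin N)) :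
    localOp S (1 : Matrix (ConfIn d S) (ConfIn d S) ℂ) = 1 := by
  simp [localOp]

theorem localOp_conjTranspose (S : Finset (Fin N)) (A : Matrix (ConfIn d S) (ConfIn d S) ℂ) :
    localOp S Aᴴ = (localOp S A)ᴴ := by
  simp [localOp, Matrix.conjTranspose_submatrix, Matrix.conjTranspose_kronecker]

theorem localOp_sub (S : Finset (Fin N)) (A B : Matrix (ConfIn d S) (ConfIn d S) ℂ) :
    localOp S (A - B) = localOp S A - localOp S B := by
  ext x y
  simp [localOp, sub_mul]

theorem localOp_add (S : Finset (Fin N)) (A B : Matrix (ConfIn d S) (ConfIn d S) ℂ) :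
    localOp S (A + B) = localOp S A + localOp S B := by
  ext x y
  simp [localOp, add_mul]

theorem localOp_mem_unitaryGroup (S : Finset (Fin N)) {A : Matrix (ConfIn d S) (ConfIn d S) ℂ}
    (hA : A ∈ Matrix.unitaryGroup (ConfIn d S) ℂ) :
    localOp S A ∈ Matrix.unitaryGroup (Conf d) ℂ := by
  rw [mem_unitaryGroup_iff, star_eq_conjTranspose] at *
  rw [← localOp_conjTranspose, ← localOp_mul, hA, localOp_one]

theorem compiledSubmonoid_le (𝒩 : Fin K → Finset (Fin N)) (ψ : EuclideanSpace ℂ (Conf d)) :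
    compiledSubmonoid 𝒩 ψ ≤ stabilizerSubmonoid ψ := by
  refine Submonoid.closure_le.2 ?_
  rintro _ ⟨k, ⟨A, hA, rfl⟩, h⟩
  exact ⟨localOp_mem_unitaryGroup _ hA, h⟩

attribute [local instance] Matrix.linftyOpNormedRing Matrix.linftyOpNormedAlgebra in
theorem eventually_mem_compiledSubmonoid {𝒩 : Fin K → Finset (Fin N)}
    {ψ : EuclideanSpace ℂ (Conf d)} (hgen : UnitaryGeneration 𝒩 ψ) :
    ∀ᶠ U in 𝓝 (1 : Matrix (Conf d) (Conf d) ℂ), U ∈ stabilizerGroup ψ →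
      U ∈ compiledSubmonoid 𝒩 ψ := by
  let _ : LieRing (Matrix (Conf d) (Conf d) ℂ) := LieRing.ofAssociativeRing
  -- The adjoint need not be isometric for the chosen algebra norm; continuity is enough.
  have : @ContinuousStar (Matrix (Conf d) (Conf d) ℂ)
      PseudoMetricSpace.toUniformSpace.toTopologicalSpace _ := ⟨continuous_id.matrix_conjTranspose⟩
  refine eventually_mem_of_le_span_oneParam (H := stabilizerSubmonoid ψ)
    (compiledSubmonoid_le 𝒩 ψ) (fun U hU => hU.1)
    (LieSubalgebra.lieSpan ℝ (Matrix (Conf d) (Conf d) ℂ)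
      (⋃ k, lieAlgebraOf (nbhdStabilizerGroup (𝒩 k) ψ))).toSubmodule hgen.symm
    (fun U hU => ?_) ?_
  · have h := sub_conjTranspose_mem_lieAlgebraOf hU
    rw [← hgen] at h
    exact h
  · refine lieSpan_le_span_oneParam _ _ ?_
    rintro X hX t
    obtain ⟨k, hk⟩ := Set.mem_iUnion.1 hX
    exact Submonoid.subset_closure ⟨k, hk t⟩

/-- The phases on the range of `Q` form a one-parameter group in the stabilizer. Phase `π / m` is
near `1`, hence compiled for some `m > 0`, and its `m`-th power is the reflection. -/
theorem reflection_mem_compiledSubmonoid {𝒩 : Fin K → Finset (Fin N)}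
    {ψ : EuclideanSpace ℂ (Conf d)} (hgen : UnitaryGeneration 𝒩 ψ)
    {Q : Matrix (Conf d) (Conf d) ℂ} (hQ : Q * Q = Q) (hQs : Qᴴ = Q)
    (hQψ : Commute Q (ketbra ψ)) : 1 - (2 : ℂ) • Q ∈ compiledSubmonoid 𝒩 ψ := by
  have hcont : Continuous (phase Q) := by unfold phase; fun_prop
  have h0 : Tendsto (fun m : ℕ => phase Q (Real.pi / m)) atTop (𝓝 1) := by
    have : phase Q 0 = 1 := by simp [phase]
    rw [← this]
    exact hcont.continuousAt.tendsto.comp (tendsto_const_div_atTop_nhds_zero_nat _)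
  obtain ⟨m, hm, hm0⟩ := ((h0.eventually (eventually_mem_compiledSubmonoid hgen)).and
    (eventually_gt_atTop 0)).exists
  have h := pow_mem (hm (phase_mem_stabilizerGroup hQ hQs hQψ _)) m
  have hm' : (m : ℝ) ≠ 0 := by positivity
  rwa [phase_pow hQ, mul_div_cancel₀ _ hm', phase_pi] at h

end Compile

/-! ### Kraus maps -/

section Kraus

open Matrix

variable {n m : Type*}

theorem tensorId_add (Φ Ψ : Matrix n n ℂ →ₗ[ℂ] Matrix n n ℂ) :
    tensorId m (Φ + Ψ) = tensorId m Φ + tensorId m Ψ := rfl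

/-- Evolutions preserve every property that each of their steps preserves. -/
theorem evolve_induction {p : Matrix n n ℂ → Prop}
    {l : List (Matrix n n ℂ →ₗ[ℂ] Matrix n n ℂ)} (h : ∀ E ∈ l, ∀ σ, p σ → p (E σ))
    {σ : Matrix n n ℂ} (hσ : p σ) : p (evolve l σ) := by
  induction l generalizing σ with
  | nil => exact hσ
  | cons E l ih =>
    exact ih (fun E' h' => h E' (List.mem_cons_of_mem _ h')) (h E List.mem_cons_self σ hσ)

theorem evolve_append (l l' : List (Matrix n n ℂ →ₗ[ℂ] Matrix n n ℂ)) (σ : Matrix n n ℂ) :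
    evolve (l ++ l') σ = evolve l' (evolve l σ) := List.foldl_append ..

variable [Fintype n]

theorem conjMap_apply (A M : Matrix n n ℂ) : conjMap A M = A * M * Aᴴ := rfl

theorem tensorId_conjMap [Fintype m] [DecidableEq m] (A : Matrix n n ℂ) :
    tensorId m (conjMap A) = conjMap (A ⊗ₖ (1 : Matrix m m ℂ)) := by
  ext M p q : 3
  obtain ⟨p1, p2⟩ := p
  obtain ⟨q1, q2⟩ := q
  simp [tensorId, conjMap_apply, Matrix.mul_apply, Fintype.sum_prod_type, Matrix.one_apply,
    conjTranspose_kronecker, apply_ite]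

theorem conjMap_ketbra (A : Matrix n n ℂ) (ψ : EuclideanSpace ℂ n) :
    conjMap A (ketbra ψ) = vecMulVec (A *ᵥ ψ.ofLp) (star (A *ᵥ ψ.ofLp)) := by
  rw [conjMap_apply, ketbra, mul_vecMulVec, vecMulVec_mul, star_mulVec]

theorem isCPTP_conjMap_add_conjMap [DecidableEq n] {A B : Matrix n n ℂ}
    (h : Aᴴ * A + Bᴴ * B = 1) : IsCPTP (conjMap A + conjMap B) := by
  constructor
  · intro k M hM
    rw [tensorId_add, tensorId_conjMap, tensorId_conjMap]
    exact (hM.mul_mul_conjTranspose_same _).add (hM.mul_mul_conjTranspose_same _)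
  · intro M
    rw [LinearMap.add_apply, trace_add, conjMap_apply, conjMap_apply, trace_mul_cycle,
      trace_mul_cycle B, ← trace_add, ← add_mul, h, one_mul]

theorem isCPTP_conjMap [DecidableEq n] {U : Matrix n n ℂ} (hU : U ∈ unitaryGroup n ℂ) :
    IsCPTP (conjMap U) := by
  have h : Uᴴ * U = 1 := Unitary.star_mul_self_of_mem hU
  have h2 := isCPTP_conjMap_add_conjMap (A := U) (B := 0) (by simpa using h)
  have h0 : conjMap (0 : Matrix n n ℂ) = 0 := by ext; simp [conjMap_apply]
  rwa [h0, add_zero] at h2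

/-- The projection onto `ψ` fixes `σ` from the left, and by taking adjoints from the right. So `σ`
is a multiple of it, and the trace fixes the scalar. Positivity plays no role. -/
theorem eq_ketbra_of_range_le {ψ : EuclideanSpace ℂ n} (hψ : star ψ.ofLp ⬝ᵥ ψ.ofLp = 1)
    {σ : Matrix n n ℂ} (hσ : σ.IsHermitian) (htr : σ.trace = 1)
    (hr : ∀ v, σ *ᵥ v ∈ Submodule.span ℂ {ψ.ofLp}) : σ = ketbra ψ := by
  classical
  have h1 : ketbra ψ * σ = σ := by
    refine Matrix.ext_of_mulVec_single fun i => ?_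
    obtain ⟨c, hc⟩ := Submodule.mem_span_singleton.1 (hr (Pi.single i 1))
    rw [← mulVec_mulVec, ← hc, mulVec_smul, ketbra, vecMulVec_mulVec, hψ]
    simp
  have h2 : σ * ketbra ψ = σ := by
    have := congrArg conjTranspose h1
    rwa [conjTranspose_mul, hσ.eq, ketbra_conjTranspose] at this
  have h3 : σ = (star ψ.ofLp ᵥ* σ ⬝ᵥ ψ.ofLp) • ketbra ψ := by
    conv_lhs => rw [← h2, ← h1]
    rw [ketbra, vecMulVec_mul, vecMulVec_mul_vecMulVec]
    simp [vecMulVec_smul]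
  have htr' : (ketbra ψ).trace = 1 := by rw [ketbra, trace_vecMulVec, dotProduct_comm, hψ]
  rw [h3, trace_smul, htr', smul_eq_mul, mul_one] at htr
  rw [h3, htr, one_smul]

end Kraus

/-! ### Neighborhood maps -/

section Neighborhood

open Matrix

variable {N K : ℕ} {d : Fin N → ℕ}

theorem localMap_add (S : Finset (Fin N))
    (F G : Matrix (ConfIn d S) (ConfIn d S) ℂ →ₗ[ℂ] Matrix (ConfIn d S) (ConfIn d S) ℂ) :
    localMap S (F + G) = localMap S F + localMap S G := rfl

theorem localMap_conjMap (S : Finset (Fin N)) (A : Matrix (ConfIn d S) (ConfIn d S) ℂ) :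
    localMap S (conjMap A) = conjMap (localOp S A) := by
  ext M : 1
  have h : localMap S (conjMap A) M = (tensorId (ConfOut d S) (conjMap A)
    (M.submatrix (splitConf d S).symm (splitConf d S).symm)).submatrix
      (splitConf d S) (splitConf d S) := rfl
  rw [h, tensorId_conjMap, conjMap_apply, conjMap_apply, localOp, conjTranspose_submatrix]
  conv_rhs => rw [show M = (M.submatrix (splitConf d S).symm (splitConf d S).symm).submatrix
    (splitConf d S) (splitConf d S) by simp]
  rw [submatrix_mul_equiv, submatrix_mul_equiv]

theorem isNeighborhoodMap_conjMap (S : Finset (Fin N))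
    {A : Matrix (ConfIn d S) (ConfIn d S) ℂ} (hA : A ∈ unitaryGroup (ConfIn d S) ℂ) :
    IsNeighborhoodMap S (conjMap (localOp S A)) :=
  ⟨isCPTP_conjMap (localOp_mem_unitaryGroup S hA), _, isCPTP_conjMap hA,
    (localMap_conjMap S A).symm⟩

theorem isNeighborhoodMap_conjMap_add_conjMap (S : Finset (Fin N))
    {A B : Matrix (ConfIn d S) (ConfIn d S) ℂ} (h : Aᴴ * A + Bᴴ * B = 1) :
    IsNeighborhoodMap S (conjMap (localOp S A) + conjMap (localOp S B)) := by
  refine ⟨isCPTP_conjMap_add_conjMap ?_, _, isCPTP_conjMap_add_conjMap h, ?_⟩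
  · rw [← localOp_conjTranspose, ← localOp_conjTranspose, ← localOp_mul, ← localOp_mul,
      ← localOp_add, h, localOp_one]
  · rw [localMap_add, localMap_conjMap, localMap_conjMap]

/-- For each basis label outside `S`, the corresponding slice of `ψ` is one of the vectors spanning
the Schmidt span. -/
theorem localOp_mulVec_eq_self (S : Finset (Fin N)) (ψ : EuclideanSpace ℂ (Conf d))
    {M : Matrix (ConfIn d S) (ConfIn d S) ℂ}
    (hM : ∀ a ∈ nbhdSchmidtSpan S ψ, M *ᵥ a.ofLp = a.ofLp) :
    localOp S M *ᵥ ψ.ofLp = ψ.ofLp := by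
  ext x
  have h := congrFun (hM _ (Submodule.subset_span ⟨(splitConf d S x).2, rfl⟩)) (splitConf d S x).1
  have h2 : (localOp S M *ᵥ ψ.ofLp) x =
      ∑ p, (M ⊗ₖ (1 : Matrix (ConfOut d S) (ConfOut d S) ℂ)) (splitConf d S x) p *
        splitVec S ψ p := by
    rw [← (splitConf d S).sum_comp]
    simp [localOp, mulVec, dotProduct, splitVec]
  rw [h2, Fintype.sum_prod_type]
  simpa [Matrix.one_apply, mulVec, dotProduct, splitVec] using h

end Neighborhood

/-! ### Stabilization by a partial isometry and reflections -/

section Stabilization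

open Matrix

variable {n : Type*} [Fintype n]

/-- A partial isometry from `Λ` into its orthogonal complement. -/
theorem exists_partialIsometry (Λ : Submodule ℂ (EuclideanSpace ℂ n))
    (h : 2 * Module.finrank ℂ Λ ≤ Module.finrank ℂ (EuclideanSpace ℂ n)) :
    ∃ J : Matrix n n ℂ, J * Jᴴ * J = J ∧ J * J = 0 ∧
      ∀ a ∈ Λ, (Jᴴ * J) *ᵥ a.ofLp = a.ofLp := by
  have hle : Module.finrank ℂ Λ ≤ Module.finrank ℂ Λᗮ := by
    have := Λ.finrank_add_finrank_orthogonal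
    omega
  let a := stdOrthonormalBasis ℂ Λ
  let c := stdOrthonormalBasis ℂ Λᗮ
  let A : Matrix n (Fin (Module.finrank ℂ Λ)) ℂ := .of fun x i => (a i : EuclideanSpace ℂ n) x
  let C : Matrix n (Fin (Module.finrank ℂ Λ)) ℂ :=
    .of fun x i => (c (Fin.castLE hle i) : EuclideanSpace ℂ n) x
  have hAA : Aᴴ * A = 1 := by
    ext i j
    have := orthonormal_iff_ite.1 a.orthonormal i j
    rw [Submodule.coe_inner, PiLp.inner_apply] at this
    simpa [A, Matrix.mul_apply, Matrix.one_apply, mul_comm] using this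
  have hCC : Cᴴ * C = 1 := by
    ext i j
    have := orthonormal_iff_ite.1 c.orthonormal (Fin.castLE hle i) (Fin.castLE hle j)
    rw [Submodule.coe_inner, PiLp.inner_apply] at this
    simpa [C, Matrix.mul_apply, Matrix.one_apply, mul_comm] using this
  have hAC : Aᴴ * C = 0 := by
    ext i j
    have := Submodule.inner_right_of_mem_orthogonal (a i).2 (c (Fin.castLE hle j)).2
    rw [PiLp.inner_apply] at this
    simpa [A, C, Matrix.mul_apply, mul_comm] using this
  -- `J = ∑ |c_i⟩⟨a_i|`, pairing a basis of `Λ` with as many orthonormal vectors of its complement.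
  refine ⟨C * Aᴴ, ?_, ?_, fun v hv => ?_⟩
  · rw [conjTranspose_mul, conjTranspose_conjTranspose]
    calc C * Aᴴ * (A * Cᴴ) * (C * Aᴴ) = C * (Aᴴ * A) * (Cᴴ * C) * Aᴴ := by
          simp only [Matrix.mul_assoc]
      _ = C * Aᴴ := by rw [hAA, hCC, Matrix.mul_one, Matrix.mul_one]
  · calc C * Aᴴ * (C * Aᴴ) = C * (Aᴴ * C) * Aᴴ := by simp only [Matrix.mul_assoc]
      _ = 0 := by rw [hAC, Matrix.mul_zero, Matrix.zero_mul]
  · have h1 : (C * Aᴴ)ᴴ * (C * Aᴴ) = A * Aᴴ := by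
      rw [conjTranspose_mul, conjTranspose_conjTranspose]
      calc A * Cᴴ * (C * Aᴴ) = A * (Cᴴ * C) * Aᴴ := by simp only [Matrix.mul_assoc]
        _ = A * Aᴴ := by rw [hCC, Matrix.mul_one]
    have h2 : v.ofLp = A *ᵥ (a.repr ⟨v, hv⟩).ofLp := by
      ext x
      have := congrArg (fun w : Λ => (w : EuclideanSpace ℂ n) x) (a.sum_repr ⟨v, hv⟩)
      simpa [A, mulVec, dotProduct, mul_comm] using this.symm
    rw [h1, h2, mulVec_mulVec, Matrix.mul_assoc, hAA, Matrix.mul_one]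

variable [DecidableEq n]

/-- The channel with Kraus operators `1 - J J†` and `J†`: for a partial isometry `J` it maps the
final space of `J` back to its initial space. -/
def returnMap (J : Matrix n n ℂ) : Matrix n n ℂ →ₗ[ℂ] Matrix n n ℂ :=
  conjMap (1 - J * Jᴴ) + conjMap Jᴴ

theorem returnMap_kraus {J : Matrix n n ℂ} (hJ : J * Jᴴ * J = J) :
    (1 - J * Jᴴ)ᴴ * (1 - J * Jᴴ) + Jᴴᴴ * Jᴴ = 1 := by
  have h : J * Jᴴ * (J * Jᴴ) = J * Jᴴ := by rw [← Matrix.mul_assoc, hJ]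
  simp only [conjTranspose_sub, conjTranspose_one, conjTranspose_mul, conjTranspose_conjTranspose,
    sub_mul, mul_sub, one_mul, mul_one, h]
  abel

theorem returnMap_mulVec (J M : Matrix n n ℂ) (v : n → ℂ) :
    returnMap J M *ᵥ v = (1 - J * Jᴴ) *ᵥ (M *ᵥ ((1 - J * Jᴴ)ᴴ *ᵥ v)) +
      Jᴴ *ᵥ (M *ᵥ (J *ᵥ v)) := by
  rw [returnMap, LinearMap.add_apply, add_mulVec, conjMap_apply, conjMap_apply]
  simp only [mulVec_mulVec, conjTranspose_conjTranspose, Matrix.mul_assoc]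

/-- `J†` kills both Kraus operators from the left. One use of the channel thus brings any operator
into the regime `range ≤ ker J†`. -/
theorem conjTranspose_mulVec_returnMap {J : Matrix n n ℂ} (hJ : J * Jᴴ * J = J) (hJJ : J * J = 0)
    (M : Matrix n n ℂ) (v : n → ℂ) : Jᴴ *ᵥ (returnMap J M *ᵥ v) = 0 := by
  have h1 : Jᴴ * (1 - J * Jᴴ) = 0 := by
    have := congrArg conjTranspose hJ
    simp only [conjTranspose_mul, conjTranspose_conjTranspose] at this
    rw [mul_sub, mul_one, this, sub_self]
  have h2 : Jᴴ * Jᴴ = 0 := by rw [← conjTranspose_mul, hJJ, conjTranspose_zero]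
  rw [returnMap_mulVec, mulVec_add, mulVec_mulVec, h1, mulVec_mulVec _ Jᴴ Jᴴ, h2]
  simp

section Fixed

variable {J : Matrix n n ℂ} {ψ : EuclideanSpace ℂ n}

theorem conjTranspose_mulVec_eq_zero (hJJ : J * J = 0) (hJψ : (Jᴴ * J) *ᵥ ψ.ofLp = ψ.ofLp) :
    Jᴴ *ᵥ ψ.ofLp = 0 := by
  rw [← hJψ, mulVec_mulVec, ← Matrix.mul_assoc, ← conjTranspose_mul, hJJ]
  simp

theorem returnMap_ketbra (hJJ : J * J = 0) (hJψ : (Jᴴ * J) *ᵥ ψ.ofLp = ψ.ofLp) :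
    returnMap J (ketbra ψ) = ketbra ψ := by
  have h := conjTranspose_mulVec_eq_zero hJJ hJψ
  have h2 : (1 - J * Jᴴ) *ᵥ ψ.ofLp = ψ.ofLp := by
    rw [sub_mulVec, ← mulVec_mulVec, h]; simp
  rw [returnMap, LinearMap.add_apply, conjMap_ketbra, conjMap_ketbra, h, h2]
  simp [ketbra]

/-- A unitary conjugation is unital, but `J†` annihilates every output of the channel, whereas `J† J
ψ = ψ ≠ 0` shows that it does not annihilate `1`. -/
theorem isDissipative_returnMap (hJ : J * Jᴴ * J = J) (hJJ : J * J = 0)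
    (hJψ : (Jᴴ * J) *ᵥ ψ.ofLp = ψ.ofLp) (hψ : ψ ≠ 0) :
    IsDissipative (returnMap J) := by
  rintro ⟨U, hU, h⟩
  have hU1 : U * Uᴴ = 1 := Unitary.mul_star_self_of_mem hU
  have h1 : returnMap J 1 = 1 := by rw [h, conjMap_apply, Matrix.mul_one, hU1]
  have h2 := conjTranspose_mulVec_returnMap hJ hJJ 1 (J *ᵥ ψ.ofLp)
  rw [h1, one_mulVec, mulVec_mulVec, hJψ] at h2
  exact hψ (by ext i; exact congrFun h2 i)

/-- Reflections that fix `ψ`, interlaced with `returnMap J`, can move the range of every operator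
with range in `L` into the line of `ψ`. -/
theorem exists_reflections_of_le (hJψ : (Jᴴ * J) *ᵥ ψ.ofLp = ψ.ofLp)
    (hψ : star ψ.ofLp ⬝ᵥ ψ.ofLp = 1) {Γ : Set (Matrix n n ℂ)}
    (hΓ : ∀ x : n → ℂ, star x ⬝ᵥ ψ.ofLp = 0 → star x ⬝ᵥ x = 2 → 1 - vecMulVec x (star x) ∈ Γ)
    (L : Submodule ℂ (n → ℂ)) (hL : ∀ v ∈ L, Jᴴ *ᵥ v = 0) (hψL : ψ.ofLp ∈ L) :
    ∃ us : List (Matrix n n ℂ), (∀ U ∈ us, U ∈ Γ) ∧ ∀ σ : Matrix n n ℂ, (∀ v, σ *ᵥ v ∈ L) →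
      ∀ v, evolve (us.map fun U => returnMap J ∘ₗ conjMap U) σ *ᵥ v ∈
        Submodule.span ℂ {ψ.ofLp} := by
  induction hm : Module.finrank ℂ L using Nat.strong_induction_on generalizing L with
  | _ m ih =>
  by_cases hle : L ≤ Submodule.span ℂ {ψ.ofLp}
  · exact ⟨[], by simp, fun σ hσ v => hle (hσ v)⟩
  obtain ⟨w, hwL, hw⟩ := SetLike.not_le_iff_exists.1 hle
  -- One Gram–Schmidt step against `ψ`.
  obtain ⟨e, heL, heψ, hee⟩ : ∃ e ∈ L, star e ⬝ᵥ ψ.ofLp = 0 ∧ star e ⬝ᵥ e = 1 := by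
    set e₀ := w - (star ψ.ofLp ⬝ᵥ w) • ψ.ofLp with he₀
    have h0 : e₀ ≠ 0 := fun h => hw (by
      rw [sub_eq_zero.1 h]; exact Submodule.smul_mem _ _ (Submodule.mem_span_singleton_self _))
    have h0L : e₀ ∈ L := L.sub_mem hwL (L.smul_mem _ hψL)
    have h0ψ : star e₀ ⬝ᵥ ψ.ofLp = 0 := by
      rw [he₀, star_sub, star_smul, sub_dotProduct, smul_dotProduct, hψ, star_dotProduct]
      simp [dotProduct_comm]
    have hpos : 0 < star e₀ ⬝ᵥ e₀ := dotProduct_star_self_pos_iff.2 h0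
    obtain ⟨r, hr, hr'⟩ : ∃ r : ℝ, 0 < r ∧ star e₀ ⬝ᵥ e₀ = (r : ℂ) := by
      refine ⟨(star e₀ ⬝ᵥ e₀).re, (Complex.pos_iff.1 hpos).1, ?_⟩
      exact (Complex.eq_re_of_ofReal_le hpos.le)
    refine ⟨((Real.sqrt r)⁻¹ : ℂ) • e₀, L.smul_mem _ h0L, ?_, ?_⟩
    · rw [star_smul, smul_dotProduct, h0ψ, smul_zero]
    · rw [star_smul, smul_dotProduct, dotProduct_smul, hr']
      have : (Real.sqrt r : ℂ) * Real.sqrt r = r := by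
        rw [← Complex.ofReal_mul, Real.mul_self_sqrt hr.le]
      have h3 : (Real.sqrt r : ℂ) ≠ 0 := by
        exact_mod_cast (Real.sqrt_pos.2 hr).ne'
      rw [← this]
      simp only [star_inv₀, smul_eq_mul, Complex.star_def, Complex.conj_ofReal]
      field_simp
  let ε : (n → ℂ) →ₗ[ℂ] ℂ := dotProductBilin ℂ ℂ (star e)
  have hε : ∀ v, ε v = star e ⬝ᵥ v := fun v => rfl
  let L' := L ⊓ LinearMap.ker ε
  have hlt : L' < L := lt_of_le_of_ne inf_le_left fun h => by
    have : e ∈ L' := h ▸ heL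
    have := LinearMap.mem_ker.1 this.2
    rw [hε, hee] at this
    exact one_ne_zero this
  have hψL' : ψ.ofLp ∈ L' := ⟨hψL, LinearMap.mem_ker.2 heψ⟩
  obtain ⟨us, hus, hev⟩ := ih _ (hm ▸ Submodule.finrank_lt_finrank_of_lt hlt) L'
    (fun v hv => hL v hv.1) hψL' rfl
  -- `φ` is a unit vector orthogonal to `L`, because `L ≤ ker J†`.
  set φ := J *ᵥ ψ.ofLp with hφ
  have hJφ : Jᴴ *ᵥ φ = ψ.ofLp := by rw [hφ, mulVec_mulVec, hJψ]
  have hφv : ∀ v, star φ ⬝ᵥ v = star ψ.ofLp ⬝ᵥ Jᴴ *ᵥ v := fun v => by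
    rw [hφ, star_mulVec, dotProduct_mulVec]
  have hφL : ∀ v ∈ L, star φ ⬝ᵥ v = 0 := fun v hv => by rw [hφv, hL v hv, dotProduct_zero]
  have hφe : star e ⬝ᵥ φ = 0 := by
    rw [star_dotProduct, hφL e heL, star_zero]
  -- Since `‖x‖² = 2`, `1 - |x⟩⟨x|` is the reflection exchanging `e` and `φ`.
  set x := e - φ with hx
  have hxψ : star x ⬝ᵥ ψ.ofLp = 0 := by
    rw [hx, star_sub, sub_dotProduct, heψ, hφL _ hψL, sub_zero]
  have hxx : star x ⬝ᵥ x = 2 := by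
    rw [hx, star_sub, sub_dotProduct, dotProduct_sub, dotProduct_sub, hee, hφe, hφL e heL,
      hφv φ, hJφ, hψ]
    norm_num
  refine ⟨(1 - vecMulVec x (star x)) :: us, ?_, fun σ hσ => ?_⟩
  · simpa using ⟨hΓ x hxψ hxx, hus⟩
  refine hev _ fun v => ?_
  have hU : ∀ u ∈ L, (1 - vecMulVec x (star x)) *ᵥ u =
      (u - (star e ⬝ᵥ u) • e) + (star e ⬝ᵥ u) • φ := fun u hu => by
    have : star x ⬝ᵥ u = star e ⬝ᵥ u := by
      rw [hx, star_sub, sub_dotProduct, hφL u hu, sub_zero]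
    rw [sub_mulVec, one_mulVec, vecMulVec_mulVec, this, hx]
    ext i
    simp
    ring
  have hmem : ∀ u ∈ L, u - (star e ⬝ᵥ u) • e ∈ L' := fun u hu =>
    ⟨L.sub_mem hu (L.smul_mem _ heL), LinearMap.mem_ker.2 (by
      rw [hε, dotProduct_sub, dotProduct_smul, hee]; simp)⟩
  -- On reflected vectors of `L`, `J†` turns the `φ` component into `ψ`, and `1 - J J†` discards it.
  -- Both results lie in `L'`.
  have hJU : ∀ u ∈ L, Jᴴ *ᵥ ((1 - vecMulVec x (star x)) *ᵥ u) = (star e ⬝ᵥ u) • ψ.ofLp :=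
    fun u hu => by rw [hU u hu, mulVec_add, hL _ (hmem u hu).1, mulVec_smul, hJφ, zero_add]
  have hAU : ∀ u ∈ L, (1 - J * Jᴴ) *ᵥ ((1 - vecMulVec x (star x)) *ᵥ u) =
      u - (star e ⬝ᵥ u) • e := fun u hu => by
    rw [sub_mulVec, one_mulVec, ← mulVec_mulVec, hJU u hu, mulVec_smul, ← hφ, hU u hu,
      add_sub_cancel_right]
  show returnMap J (conjMap _ σ) *ᵥ v ∈ L'
  rw [returnMap_mulVec, conjMap_apply, ← mulVec_mulVec, ← mulVec_mulVec,
    ← mulVec_mulVec, ← mulVec_mulVec, hAU _ (hσ _), hJU _ (hσ _)]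
  exact L'.add_mem (hmem _ (hσ _)) (L'.smul_mem _ hψL')

/-- Reflections that fix `ψ`, interlaced with `returnMap J`, can prepare `ψ`. -/
theorem exists_reflections (hJ : J * Jᴴ * J = J) (hJJ : J * J = 0)
    (hJψ : (Jᴴ * J) *ᵥ ψ.ofLp = ψ.ofLp) (hψ : star ψ.ofLp ⬝ᵥ ψ.ofLp = 1)
    {Γ : Set (Matrix n n ℂ)}
    (hΓ : ∀ x : n → ℂ, star x ⬝ᵥ ψ.ofLp = 0 → star x ⬝ᵥ x = 2 → 1 - vecMulVec x (star x) ∈ Γ)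
    (hΓ1 : 1 ∈ Γ) (hΓu : Γ ⊆ unitaryGroup n ℂ) :
    ∃ us : List (Matrix n n ℂ), (∀ U ∈ us, U ∈ Γ) ∧ ∀ σ : Matrix n n ℂ, IsDensity σ →
      evolve (us.map fun U => returnMap J ∘ₗ conjMap U) σ = ketbra ψ := by
  obtain ⟨us, hus, hev⟩ := exists_reflections_of_le hJψ hψ hΓ (LinearMap.ker Jᴴ.mulVecLin)
    (fun v hv => hv) (conjTranspose_mulVec_eq_zero hJJ hJψ)
  have hall : ∀ U ∈ 1 :: us, U ∈ Γ := by simpa using ⟨hΓ1, hus⟩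
  -- The leading `1` inserts a bare application of the channel, which moves the arbitrary initial
  -- range into `ker J†`.
  refine ⟨1 :: us, hall, fun σ hσ => ?_⟩
  obtain ⟨h1, h2⟩ := evolve_induction (p := fun σ : Matrix n n ℂ => σ.IsHermitian ∧ σ.trace = 1)
    (l := (1 :: us).map fun U => returnMap J ∘ₗ conjMap U) (fun E hE τ hτ => by
      obtain ⟨U, hU, rfl⟩ := List.mem_map.1 hE
      refine ⟨?_, ?_⟩
      · exact ((isHermitian_mul_mul_conjTranspose _ (isHermitian_mul_mul_conjTranspose U hτ.1)).add
          (isHermitian_mul_mul_conjTranspose _ (isHermitian_mul_mul_conjTranspose U hτ.1)))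
      · rw [LinearMap.comp_apply, returnMap,
          (isCPTP_conjMap_add_conjMap (returnMap_kraus hJ)).2,
          (isCPTP_conjMap (hΓu (hall U hU))).2, hτ.2]) ⟨hσ.1.isHermitian, hσ.2⟩
  refine eq_ketbra_of_range_le hψ h1 h2 (hev _ fun v => ?_)
  exact conjTranspose_mulVec_returnMap hJ hJJ _ v

end Fixed

end Stabilization

/-! ### Finite-time stabilization -/

section FiniteTime

open Matrix

variable {N K : ℕ} {d : Fin N → ℕ}

theorem exists_evolve_eq_conjMap {𝒩 : Fin K → Finset (Fin N)} {ψ : EuclideanSpace ℂ (Conf d)}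
    {U : Matrix (Conf d) (Conf d) ℂ} (hU : IsCompiled 𝒩 ψ U) :
    ∃ l : List (Matrix (Conf d) (Conf d) ℂ →ₗ[ℂ] Matrix (Conf d) (Conf d) ℂ),
      (∀ E ∈ l, (∃ k, IsNeighborhoodMap (𝒩 k) E) ∧ E (ketbra ψ) = ketbra ψ) ∧
        ∀ σ, evolve l σ = conjMap U σ := by
  obtain ⟨vs, hvs, rfl⟩ := hU
  induction vs with
  | nil => exact ⟨[], by simp, fun σ => by simp [evolve, conjMap_apply]⟩
  | cons V vs ih =>
    obtain ⟨l, hl, hev⟩ := ih fun V' h => hvs V' (List.mem_cons_of_mem _ h)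
    obtain ⟨k, ⟨A, hA, rfl⟩, hV⟩ := hvs V List.mem_cons_self
    -- The leftmost factor of a product acts last, hence goes to the end of the list.
    refine ⟨l ++ [conjMap (localOp (𝒩 k) A)], fun E hE => ?_, fun σ => ?_⟩
    · rcases List.mem_append.1 hE with h | h
      · exact hl E h
      · rw [List.mem_singleton.1 h]
        exact ⟨⟨k, isNeighborhoodMap_conjMap _ hA⟩, hV⟩
    · rw [evolve_append, hev]
      simp [evolve, conjMap_apply, Matrix.mul_assoc]

theorem isFTS_of_evolve_eq {𝒩 : Fin K → Finset (Fin N)} {ψ : EuclideanSpace ℂ (Conf d)} {k : Fin K}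
    {W : Matrix (Conf d) (Conf d) ℂ →ₗ[ℂ] Matrix (Conf d) (Conf d) ℂ}
    (hW : IsNeighborhoodMap (𝒩 k) W) (hWψ : W (ketbra ψ) = ketbra ψ)
    {us : List (Matrix (Conf d) (Conf d) ℂ)} (hus : ∀ U ∈ us, IsCompiled 𝒩 ψ U)
    (hev : ∀ σ, IsDensity σ → evolve (us.map fun U => W ∘ₗ conjMap U) σ = ketbra ψ) :
    IsFTS 𝒩 (ketbra ψ) := by
  classical
  obtain ⟨l, hl, hlev⟩ :
      ∃ l : List (Matrix (Conf d) (Conf d) ℂ →ₗ[ℂ] Matrix (Conf d) (Conf d) ℂ),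
        (∀ E ∈ l, (∃ k, IsNeighborhoodMap (𝒩 k) E) ∧ E (ketbra ψ) = ketbra ψ) ∧
          ∀ σ, evolve l σ = evolve (us.map fun U => W ∘ₗ conjMap U) σ := by
    clear hev
    induction us with
    | nil => exact ⟨[], by simp, fun σ => rfl⟩
    | cons U us ih =>
      obtain ⟨l, hl, hlev⟩ := ih fun V h => hus V (List.mem_cons_of_mem _ h)
      obtain ⟨l', hl', hlev'⟩ := exists_evolve_eq_conjMap (hus U List.mem_cons_self)
      refine ⟨l' ++ W :: l, fun E hE => ?_, fun σ => ?_⟩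
      · rcases List.mem_append.1 hE with h | h
        · exact hl' E h
        · rcases List.mem_cons.1 h with rfl | h
          · exact ⟨⟨k, hW⟩, hWψ⟩
          · exact hl E h
      · rw [evolve_append, hlev']
        exact hlev (W (conjMap U σ))
  have h : ∃ T, HasStabilizingSequence 𝒩 (ketbra ψ) T :=
    ⟨l.length, l, rfl, hl, fun σ hσ => (hlev σ).trans (hev σ hσ)⟩
  exact ⟨Nat.find h, Nat.find_spec h, fun T' hT' => Nat.find_min h hT'⟩

theorem one_sub_vecMulVec_mem_compiledSubmonoid {𝒩 : Fin K → Finset (Fin N)}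
    {ψ : EuclideanSpace ℂ (Conf d)} (hgen : UnitaryGeneration 𝒩 ψ) {x : Conf d → ℂ}
    (hxψ : star x ⬝ᵥ ψ.ofLp = 0) (hxx : star x ⬝ᵥ x = 2) :
    1 - vecMulVec x (star x) ∈ compiledSubmonoid 𝒩 ψ := by
  have hψx : star ψ.ofLp ⬝ᵥ x = 0 := by rw [star_dotProduct, hxψ, star_zero]
  -- The factor `2⁻¹` normalizes `|x⟩⟨x|` to a projection, as `‖x‖² = 2`.
  have h := reflection_mem_compiledSubmonoid hgen (Q := (2⁻¹ : ℂ) • vecMulVec x (star x))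
    (by
      rw [smul_mul_smul_comm, vecMulVec_mul_vecMulVec, hxx, vecMulVec_smul, smul_smul]
      norm_num)
    (by rw [conjTranspose_smul, conjTranspose_vecMulVec, star_star]; simp)
    (Commute.smul_left (by
      rw [commute_iff_eq, ketbra, vecMulVec_mul_vecMulVec, vecMulVec_mul_vecMulVec, hxψ, hψx]
      simp) _)
  simpa [smul_smul] using h

end FiniteTime

end QLStab

end

theorem mainTheorem2 {N K : ℕ} (d : Fin N → ℕ) (𝒩 : Fin K → Finset (Fin N))
    (ψ : EuclideanSpace ℂ (QLStab.Conf d)) (hψ : ‖ψ‖ = 1)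
    (hconn : QLStab.IsConnectedStructure 𝒩)
    (k : Fin K) (hk : QLStab.SmallSchmidtSpan (𝒩 k) ψ)
    (hgen : QLStab.UnitaryGeneration 𝒩 ψ) :
    QLStab.IsFTS 𝒩 (QLStab.ketbra ψ) ∧
      ∃ W : Matrix (QLStab.Conf d) (QLStab.Conf d) ℂ →ₗ[ℂ]
          Matrix (QLStab.Conf d) (QLStab.Conf d) ℂ,
        QLStab.IsNeighborhoodMap (𝒩 k) W ∧
        QLStab.IsDissipative W ∧
        W (QLStab.ketbra ψ) = QLStab.ketbra ψ ∧
        ∃ us : List (Matrix (QLStab.Conf d) (QLStab.Conf d) ℂ),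
          (∀ U ∈ us, U ∈ QLStab.stabilizerGroup ψ ∧ QLStab.IsCompiled 𝒩 ψ U) ∧
          ∀ σ, QLStab.IsDensity σ →
            QLStab.evolve (us.map fun U => W ∘ₗ QLStab.conjMap U) σ = QLStab.ketbra ψ := by
  open QLStab Matrix in
  obtain ⟨J₀, hJ₀, hJJ₀, hJΛ⟩ := exists_partialIsometry (nbhdSchmidtSpan (𝒩 k) ψ) hk
  -- `localOp` respects products and adjoints, so `J` inherits the relations of `J₀`, and `returnMap
  -- J` acts on the neighborhood only.
  set J := localOp (𝒩 k) J₀ with hJdef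
  have hJ : J * Jᴴ * J = J := by
    rw [hJdef, ← localOp_conjTranspose, ← localOp_mul, ← localOp_mul, hJ₀]
  have hJJ : J * J = 0 := by
    rw [hJdef, ← localOp_mul, hJJ₀]
    simp [localOp]
  have hJψ : (Jᴴ * J) *ᵥ ψ.ofLp = ψ.ofLp := by
    rw [hJdef, ← localOp_conjTranspose, ← localOp_mul]
    exact localOp_mulVec_eq_self _ _ hJΛ
  have hψ1 : star ψ.ofLp ⬝ᵥ ψ.ofLp = 1 := by
    have := inner_self_eq_norm_sq_to_K (𝕜 := ℂ) ψ
    rw [hψ, EuclideanSpace.inner_eq_star_dotProduct, dotProduct_comm] at this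
    simpa using this
  have hψ0 : ψ ≠ 0 := by
    rintro rfl
    simp at hψ
  have hW : IsNeighborhoodMap (𝒩 k) (returnMap J) := by
    have := isNeighborhoodMap_conjMap_add_conjMap (𝒩 k) (returnMap_kraus hJ₀)
    rwa [localOp_sub, localOp_one, localOp_mul, localOp_conjTranspose] at this
  have hWψ := returnMap_ketbra hJJ hJψ
  obtain ⟨us, hus, hev⟩ := exists_reflections hJ hJJ hJψ hψ1 (Γ := compiledSubmonoid 𝒩 ψ)
    (fun x => one_sub_vecMulVec_mem_compiledSubmonoid hgen) (one_mem _)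
    (fun U hU => (compiledSubmonoid_le 𝒩 ψ hU).1)
  exact ⟨isFTS_of_evolve_eq hW hWψ (fun U hU => isCompiled_of_mem (hus U hU)) hev, returnMap J, hW,
    isDissipative_returnMap hJ hJJ hJψ hψ0, hWψ, us,
    fun U hU => ⟨compiledSubmonoid_le 𝒩 ψ (hus U hU), isCompiled_of_mem (hus U hU)⟩, hev⟩
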